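/- Let $X$ be a compact connected Riemann surface, let $\mathrm{Aut}^\pm(X)$ be the group of automorphisms of $X$ that are holomorphic or anti-holomorphic, and let $\Sigma$ be a subgroup of $\mathrm{Aut}^\pm(X)$. For $\sigma\in\Sigma$ and a holomorphic vector bundle $\mathcal{E}$ on $X$ of rank $r$ defined by a holomorphic $1$-cocycle $g_{ij}:U_i\cap U_j\to \mathbf{GL}(r;\mathbb{C})$ on an open cover $(U_i)$ of $X$, let $\sigma(\mathcal{E})$ be the holomorphic vector bundle defined, on the open cover $(\sigma(U_i))$, by the holomorphic $1$-cocycle $g_{ij}\circ\sigma^{-1}$ if $\sigma$ is holomorphic, and $\overline{g_{ij}\circ\sigma^{-1}}$ if $\sigma$ is anti-holomorphic. Call $\mathcal{E}$ stable if $\deg(\mathcal{F}^*\otimes\mathcal{E})>0$ for every holomorphic sub-bundle $\mathcal{F}\subset\mathcal{E}$ with $\mathcal{F}\neq 0,\mathcal{E}$, and let $\mathcal{M}_X(r,d)$ be the moduli space of isomorphism classes of stable holomorphic vector bundles of rank $r$ and degree $d$ on $X$. (The degree of a bundle is the degree of the divisor of any not identically zero meromorphic section of its determinant line bundle.) (1)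 For every $\sigma\in\Sigma$ and every holomorphic vector bundle $\mathcal{E}$ on $X$, the bundle $\sigma(\mathcal{E})$ is stable if and only if $\mathcal{E}$ is stable. (2) For all $r$ and $d$, there is an action of the group $\Sigma$ on $\mathcal{M}_X(r,d)$ such that $\sigma\cdot[\mathcal{E}]=[\sigma(\mathcal{E})]$ for all $\sigma\in\Sigma$ and $[\mathcal{E}]\in\mathcal{M}_X(r,d)$; in particular $\sigma(\mathcal{E})$ is again stable of degree $d$. In this action, $\sigma$ acts by a holomorphic transformation of $\mathcal{M}_X(r,d)$ if $\sigma$ is holomorphic, and by an anti-holomorphic one if $\sigma$ is anti-holomorphic. Here a map from an open subset $T$ of $\mathbb{C}^m$ to $\mathcal{M}_X(r,d)$ is called holomorphic if, locally on $T$, it is of the form $t\mapsto[\mathcal{W}|_{X\times\{t\}}]$ for a holomorphic vector bundle $\mathcal{W}$ on $X\times T$; and a transformation $f$ of $\mathcal{M}_X(r,d)$ is called holomorphic (resp. anti-holomorphic) if, for every such holomorphic map $p$, the map $t\mapsto f(p(t))$ on $T$ (resp. $t\mapsto f(p(\bar t))$ on the complex conjugate of $T$) is holomorphic. -/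

import Mathlib

open Set Topology
open scoped Manifold ContDiff ComplexConjugate Kronecker

universe u

section Maps

variable {X : Type u} [TopologicalSpace X] [ChartedSpace ℂ X]
variable {Y : Type u} [TopologicalSpace Y] [ChartedSpace ℂ Y]
variable {Z : Type u} [TopologicalSpace Z] [ChartedSpace ℂ Z]

/-- `f` is anti-holomorphic: it is continuous and, near every point `x`, the complex conjugate of
the local coordinate of `f` is holomorphic. -/
def IsAntiholomorphic (f : X → Y) : Prop :=
  Continuous f ∧
    ∀ x : X, MDifferentiableAt 𝓘(ℂ) 𝓘(ℂ) (fun y => conj (chartAt ℂ (f x) (f y))) x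

/-- Precomposing a holomorphic function with an anti-holomorphic map and conjugating gives a
holomorphic function. -/
theorem IsAntiholomorphic.conj_comp [IsManifold 𝓘(ℂ) ω Y] {f : X → Y} (hf : IsAntiholomorphic f)
    {φ : Y → ℂ} {x : X} (hφ : MDifferentiableAt 𝓘(ℂ) 𝓘(ℂ) φ (f x)) :
    MDifferentiableAt 𝓘(ℂ) 𝓘(ℂ) (fun y => conj (φ (f y))) x := by
  set e := chartAt ℂ (f x) with he
  have hsrc : f x ∈ e.source := mem_chart_source ℂ (f x)
  have h1 : DifferentiableAt ℂ (φ ∘ e.symm) (e (f x)) := by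
    have h := hφ.differentiableWithinAt_writtenInExtChartAt
    simpa [writtenInExtChartAt, differentiableWithinAt_univ, he, Function.comp_def,
      chartAt_self_eq] using h
  have h2 : DifferentiableAt ℂ (conj ∘ (φ ∘ e.symm) ∘ conj) (conj (e (f x))) := by
    have : DifferentiableAt ℂ (φ ∘ e.symm) (conj (conj (e (f x)))) := by simpa using h1
    simpa using this.conj_conj
  have h3 : MDifferentiableAt 𝓘(ℂ) 𝓘(ℂ)
      ((conj ∘ (φ ∘ e.symm) ∘ conj) ∘ fun y => conj (e (f y))) x :=
    h2.mdifferentiableAt.comp x (hf.2 x)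
  refine h3.congr_of_eventuallyEq ?_
  have hn : f ⁻¹' e.source ∈ 𝓝 x :=
    hf.1.continuousAt.preimage_mem_nhds (e.open_source.mem_nhds hsrc)
  filter_upwards [hn] with y hy
  simp [e.left_inv hy]

theorem IsAntiholomorphic.comp_holomorphic {f : Y → Z} {g : X → Y} (hf : IsAntiholomorphic f)
    (hg : MDifferentiable 𝓘(ℂ) 𝓘(ℂ) g) : IsAntiholomorphic (f ∘ g) :=
  ⟨hf.1.comp hg.continuous, fun x => (hf.2 (g x)).comp x (hg x)⟩

theorem IsAntiholomorphic.holomorphic_comp [IsManifold 𝓘(ℂ) ω Y] [IsManifold 𝓘(ℂ) ω Z]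
    {f : Y → Z} {g : X → Y}
    (hf : MDifferentiable 𝓘(ℂ) 𝓘(ℂ) f) (hg : IsAntiholomorphic g) :
    IsAntiholomorphic (f ∘ g) :=
  ⟨hf.continuous.comp hg.1, fun x =>
    hg.conj_comp (φ := fun y => chartAt ℂ (f (g x)) (f y))
      ((mdifferentiableAt_iff_target.1 (hf (g x))).2)⟩

theorem IsAntiholomorphic.comp [IsManifold 𝓘(ℂ) ω Y] [IsManifold 𝓘(ℂ) ω Z]
    {f : Y → Z} {g : X → Y}
    (hf : IsAntiholomorphic f) (hg : IsAntiholomorphic g) :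
    MDifferentiable 𝓘(ℂ) 𝓘(ℂ) (f ∘ g) := by
  intro x
  refine mdifferentiableAt_iff_target.2 ⟨(hf.1.comp hg.1).continuousAt, ?_⟩
  have h := hg.conj_comp (hf.2 (g x))
  simp only [Complex.conj_conj] at h
  exact h

end Maps

section Automorphisms

variable (X : Type u) [TopologicalSpace X] [ChartedSpace ℂ X] [IsManifold 𝓘(ℂ) ω X]

/-- The group `Aut^±(X)` of the automorphisms of `X` that are either holomorphic (with holomorphic
inverse) or anti-holomorphic (with anti-holomorphic inverse). The group law is composition. -/
def AutPM : Subgroup (X ≃ₜ X) where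
  carrier := {σ | (MDifferentiable 𝓘(ℂ) 𝓘(ℂ) (σ : X → X) ∧
      MDifferentiable 𝓘(ℂ) 𝓘(ℂ) (σ.symm : X → X)) ∨
    (IsAntiholomorphic (σ : X → X) ∧ IsAntiholomorphic (σ.symm : X → X))}
  one_mem' := Or.inl ⟨mdifferentiable_id, mdifferentiable_id⟩
  inv_mem' := by
    rintro σ (⟨h, h'⟩ | ⟨h, h'⟩)
    · exact Or.inl ⟨h', h⟩
    · exact Or.inr ⟨h', h⟩
  mul_mem' := by
    rintro σ τ (⟨h, h'⟩ | ⟨h, h'⟩) (⟨k, k'⟩ | ⟨k, k'⟩)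
    · exact Or.inl ⟨h.comp k, k'.comp h'⟩
    · have hk : IsAntiholomorphic (σ ∘ τ) := IsAntiholomorphic.holomorphic_comp h k
      exact Or.inr ⟨hk, k'.comp_holomorphic h'⟩
    · have hk : IsAntiholomorphic (τ.symm ∘ σ.symm) := IsAntiholomorphic.holomorphic_comp k' h'
      exact Or.inr ⟨h.comp_holomorphic k, hk⟩
    · exact Or.inl ⟨h.comp k, k'.comp h'⟩

variable {X}

open Classical in
/-- The field automorphism of `ℂ` attached to `σ`: the identity if `σ` is holomorphic, complex
conjugation if `σ` is anti-holomorphic. Applied to the entries of an invertible matrix it is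
`θ_σ` for the real form `g ↦ conj g` of `GL(r, ℂ)`. -/
noncomputable def autTwist (σ : AutPM X) : ℂ →+* ℂ :=
  if MDifferentiable 𝓘(ℂ) 𝓘(ℂ) (σ.1 : X → X) then RingHom.id ℂ else starRingEnd ℂ

/-- If `φ` is a holomorphic function then so is `θ_σ ∘ φ ∘ σ⁻¹`. -/
theorem mdifferentiableAt_autTwist (σ : AutPM X) {φ : X → ℂ} {x : X}
    (hφ : MDifferentiableAt 𝓘(ℂ) 𝓘(ℂ) φ (σ.1.symm x)) :
    MDifferentiableAt 𝓘(ℂ) 𝓘(ℂ) (fun y => autTwist σ (φ (σ.1.symm y))) x := by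
  unfold autTwist
  split_ifs with h
  · rcases σ.2 with ⟨_, h'⟩ | ⟨k, k'⟩
    · exact hφ.comp x (h' x)
    · -- here `σ` is both holomorphic and anti-holomorphic, hence so is its inverse
      have hid : IsAntiholomorphic (id : X → X) := by
        have := k'.comp_holomorphic h
        simpa [Function.comp_def, Function.id_def] using this
      have h' : MDifferentiable 𝓘(ℂ) 𝓘(ℂ) (σ.1.symm : X → X) := by
        have := hid.comp k'
        simpa using this
      exact hφ.comp x (h' x)
  · rcases σ.2 with ⟨k, _⟩ | ⟨_, k'⟩
    · exact absurd k h
    · exact k'.conj_comp hφ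

end Automorphisms

/-- A holomorphic vector bundle, given by a holomorphic `1`-cocycle, over (a neighbourhood of) the
subset `S` of the complex manifold `M`; the finite type `n` indexes the coordinates of the fibre
`ℂⁿ`, so that the rank is the cardinality of `n`. The matrix `g i j x` transforms the coordinates
of the `j`-th trivialization to those of the `i`-th one; only its values for `x ∈ U i ∩ U j` matter,
and there it is invertible, with inverse `g j i x`. -/
structure HolBundleOn {V : Type*} [NormedAddCommGroup V] [NormedSpace ℂ V] {H : Type*}
    [TopologicalSpace H] (I : ModelWithCorners ℂ V H) {M : Type u} [TopologicalSpace M]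
    [ChartedSpace H M] (S : Set M) (n : Type) [Fintype n] [DecidableEq n] where
  /-- the indices of the open cover -/
  ι : Type u
  /-- the open sets of the cover -/
  U : ι → Set M
  isOpen_U : ∀ i, IsOpen (U i)
  cover : ∀ x ∈ S, ∃ i, x ∈ U i
  /-- the transition matrices -/
  g : ι → ι → M → Matrix n n ℂ
  holomorphic_g : ∀ i j p q, MDifferentiableOn I 𝓘(ℂ) (fun x => g i j x p q) (U i ∩ U j)
  g_self : ∀ i, ∀ x ∈ U i, g i i x = 1
  g_mul : ∀ i j k, ∀ x ∈ U i ∩ U j ∩ U k, g i j x * g j k x = g i k x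

/-- Holomorphic vector bundles on the Riemann surface `X`. -/
abbrev HolBundle (X : Type u) [TopologicalSpace X] [ChartedSpace ℂ X] (n : Type) [Fintype n]
    [DecidableEq n] :=
  HolBundleOn 𝓘(ℂ) (univ : Set X) n

namespace HolBundle

variable {X : Type u} [TopologicalSpace X] [ChartedSpace ℂ X]
variable {l m n : Type} [Fintype l] [DecidableEq l] [Fintype m] [DecidableEq m]
  [Fintype n] [DecidableEq n]

/-- The bundle `σ(E)`: the cover is `(σ(U i))` and the cocycle is `θ_σ ∘ g i j ∘ σ⁻¹`, that is
`g i j ∘ σ⁻¹` if `σ` is holomorphic and `conj (g i j ∘ σ⁻¹)` if `σ` is anti-holomorphic. -/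
noncomputable def act [IsManifold 𝓘(ℂ) ω X] (σ : AutPM X) (E : HolBundle X n) :
    HolBundle X n where
  ι := E.ι
  U i := σ.1 '' E.U i
  isOpen_U i := σ.1.isOpenMap _ (E.isOpen_U i)
  cover x _ := by
    obtain ⟨i, hi⟩ := E.cover (σ.1.symm x) (mem_univ _)
    exact ⟨i, σ.1.symm x, hi, σ.1.apply_symm_apply x⟩
  g i j x := (E.g i j (σ.1.symm x)).map (autTwist σ)
  holomorphic_g i j p q := by
    rintro _ ⟨⟨x, hx, rfl⟩, ⟨y, hy, hxy⟩⟩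
    obtain rfl := σ.1.injective hxy
    refine MDifferentiableAt.mdifferentiableWithinAt ?_
    refine mdifferentiableAt_autTwist σ (φ := fun x => E.g i j x p q) ?_
    rw [σ.1.symm_apply_apply]
    exact (E.holomorphic_g i j p q).mdifferentiableAt
      (((E.isOpen_U i).inter (E.isOpen_U j)).mem_nhds ⟨hx, hy⟩)
  g_self i := by
    rintro _ ⟨x, hx, rfl⟩
    simp [E.g_self i x hx]
  g_mul i j k := by
    rintro _ ⟨⟨⟨x, hx, rfl⟩, ⟨y, hy, hxy⟩⟩, ⟨z, hz, hxz⟩⟩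
    obtain rfl := σ.1.injective hxy
    obtain rfl := σ.1.injective hxz
    rw [σ.1.symm_apply_apply, ← Matrix.map_mul, E.g_mul i j k _ ⟨⟨hx, hy⟩, hz⟩]

/-- The dual bundle: the cocycle is the inverse transpose. -/
def dual (E : HolBundle X n) : HolBundle X n where
  ι := E.ι
  U := E.U
  isOpen_U := E.isOpen_U
  cover := E.cover
  g i j x := (E.g j i x).transpose
  holomorphic_g i j p q := by
    rw [inter_comm]
    exact E.holomorphic_g j i q p
  g_self i x hx := by simp [E.g_self i x hx]
  g_mul i j k x hx := by
    rw [← Matrix.transpose_mul, E.g_mul k j i x ⟨⟨hx.2, hx.1.2⟩, hx.1.1⟩]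

/-- The tensor product of two bundles: the cocycle is the Kronecker product. -/
def tensor (F : HolBundle X m) (E : HolBundle X n) : HolBundle X (m × n) where
  ι := F.ι × E.ι
  U i := F.U i.1 ∩ E.U i.2
  isOpen_U i := (F.isOpen_U i.1).inter (E.isOpen_U i.2)
  cover x hx := by
    obtain ⟨a, ha⟩ := F.cover x hx
    obtain ⟨i, hi⟩ := E.cover x hx
    exact ⟨(a, i), ha, hi⟩
  g i j x := F.g i.1 j.1 x ⊗ₖ E.g i.2 j.2 x
  holomorphic_g i j p q := by
    have h1 := (F.holomorphic_g i.1 j.1 p.1 q.1).mono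
      (show (F.U i.1 ∩ E.U i.2) ∩ (F.U j.1 ∩ E.U j.2) ⊆ F.U i.1 ∩ F.U j.1 from
        fun x hx => ⟨hx.1.1, hx.2.1⟩)
    have h2 := (E.holomorphic_g i.2 j.2 p.2 q.2).mono
      (show (F.U i.1 ∩ E.U i.2) ∩ (F.U j.1 ∩ E.U j.2) ⊆ E.U i.2 ∩ E.U j.2 from
        fun x hx => ⟨hx.1.2, hx.2.2⟩)
    exact h1.mul h2
  g_self i x hx := by simp [F.g_self i.1 x hx.1, E.g_self i.2 x hx.2]
  g_mul i j k x hx := by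
    rw [← Matrix.mul_kronecker_mul, F.g_mul _ _ _ x ⟨⟨hx.1.1.1, hx.1.2.1⟩, hx.2.1⟩,
      E.g_mul _ _ _ x ⟨⟨hx.1.1.2, hx.1.2.2⟩, hx.2.2⟩]

/-- `E` has degree `d`: the line bundle `det E` has a meromorphic section that vanishes identically
on no non-empty open set, and whose divisor `D` has degree `d`. The section is given by its
expressions `s i` in the trivializations of `det E` over `U i`; meromorphy and the order at a point
are read in the chart at this point. (On a compact connected Riemann surface such a section always
exists, and the degree of its divisor depends only on `E`.) -/
def HasDegree (E : HolBundle X n) (d : ℤ) : Prop :=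
  ∃ (s : E.ι → X → ℂ) (D : X → ℤ),
    (∀ i j, ∀ x ∈ E.U i ∩ E.U j, s i x = (E.g i j x).det * s j x) ∧
    (∀ i, ∀ x ∈ E.U i,
      MeromorphicAt (s i ∘ (chartAt ℂ x).symm) (chartAt ℂ x x) ∧
      meromorphicOrderAt (s i ∘ (chartAt ℂ x).symm) (chartAt ℂ x x) = (D x : WithTop ℤ)) ∧
    D.support.Finite ∧ ∑ᶠ x, D x = d

/-- The family of matrices `φ` is a homomorphism of holomorphic vector bundles from `F` to `E`:
`φ i a` is its expression in the trivializations of `F` over `F.U a` and of `E` over `E.U i`. -/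
structure IsHom (F : HolBundle X m) (E : HolBundle X n)
    (φ : E.ι → F.ι → X → Matrix n m ℂ) : Prop where
  holomorphic : ∀ i a p q,
    MDifferentiableOn 𝓘(ℂ) 𝓘(ℂ) (fun x => φ i a x p q) (E.U i ∩ F.U a)
  compat : ∀ i j a b, ∀ x ∈ (E.U i ∩ E.U j) ∩ (F.U a ∩ F.U b),
    φ i a x * F.g a b x = E.g i j x * φ j b x

/-- `F` is (isomorphic to) a holomorphic sub-bundle of `E`: there is a homomorphism of holomorphic
vector bundles from `F` to `E` that is injective on every fibre. -/
def IsSubbundle (F : HolBundle X m) (E : HolBundle X n) : Prop :=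
  ∃ φ : E.ι → F.ι → X → Matrix n m ℂ, IsHom F E φ ∧
    ∀ i a, ∀ x ∈ E.U i ∩ F.U a, Function.Injective (φ i a x).mulVec

/-- `E` and `F` are isomorphic holomorphic vector bundles. -/
def IsIso (E : HolBundle X n) (F : HolBundle X m) : Prop :=
  ∃ (φ : F.ι → E.ι → X → Matrix m n ℂ) (ψ : E.ι → F.ι → X → Matrix n m ℂ),
    IsHom E F φ ∧ IsHom F E ψ ∧
    ∀ a i, ∀ x ∈ F.U a ∩ E.U i, φ a i x * ψ i a x = 1 ∧ ψ i a x * φ a i x = 1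

/-- The bundle `E` is stable: `deg (F* ⊗ E) > 0` for every holomorphic sub-bundle `F` of `E` other
than `0` and `E`. -/
def IsStable {r : ℕ} (E : HolBundle X (Fin r)) : Prop :=
  ∀ (k : ℕ) (F : HolBundle X (Fin k)), 0 < k → k < r → IsSubbundle F E →
    ∃ d : ℤ, HasDegree (tensor (dual F) E) d ∧ 0 < d

theorem IsHom.id (E : HolBundle X n) : IsHom E E E.g :=
  ⟨E.holomorphic_g, fun i j a b x hx => by
    rw [E.g_mul i a b x ⟨⟨hx.1.1, hx.2.1⟩, hx.2.2⟩, E.g_mul i j b x ⟨hx.1, hx.2.2⟩]⟩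

/-- An index of the cover whose open set contains `x`. -/
noncomputable def idx (E : HolBundle X n) (x : X) : E.ι := (E.cover x (mem_univ x)).choose

theorem mem_idx (E : HolBundle X n) (x : X) : x ∈ E.U (E.idx x) :=
  (E.cover x (mem_univ x)).choose_spec

/-- The composition of two families of matrices does not depend on the intermediate index. -/
theorem IsHom.comp_eq {E : HolBundle X n} {F : HolBundle X m} {G : HolBundle X l}
    {φ : F.ι → E.ι → X → Matrix m n ℂ} {ψ : G.ι → F.ι → X → Matrix l m ℂ}
    (hφ : IsHom E F φ) (hψ : IsHom F G ψ) {c i a b} {x : X} (hc : x ∈ G.U c) (hi : x ∈ E.U i)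
    (ha : x ∈ F.U a) (hb : x ∈ F.U b) :
    ψ c a x * φ a i x = ψ c b x * φ b i x := by
  have h1 := hφ.compat a b i i x ⟨⟨ha, hb⟩, hi, hi⟩
  have h2 := hψ.compat c c a b x ⟨⟨hc, hc⟩, ha, hb⟩
  rw [E.g_self i x hi, Matrix.mul_one] at h1
  rw [G.g_self c x hc, Matrix.one_mul] at h2
  rw [h1, ← h2, Matrix.mul_assoc]

theorem IsHom.comp {E : HolBundle X n} {F : HolBundle X m} {G : HolBundle X l}
    {φ : F.ι → E.ι → X → Matrix m n ℂ} {ψ : G.ι → F.ι → X → Matrix l m ℂ}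
    (hφ : IsHom E F φ) (hψ : IsHom F G ψ) :
    IsHom E G (fun c i x => ψ c (F.idx x) x * φ (F.idx x) i x) where
  holomorphic c i p q := by
    intro x hx
    set a := F.idx x
    have ha : x ∈ F.U a := F.mem_idx x
    refine MDifferentiableAt.mdifferentiableWithinAt ?_
    have hO : IsOpen ((G.U c ∩ E.U i) ∩ F.U a) :=
      ((G.isOpen_U c).inter (E.isOpen_U i)).inter (F.isOpen_U a)
    have hn : (G.U c ∩ E.U i) ∩ F.U a ∈ 𝓝 x := hO.mem_nhds ⟨hx, ha⟩
    have key : MDifferentiableAt 𝓘(ℂ) 𝓘(ℂ) (fun y => ∑ t, ψ c a y p t * φ a i y t q) x := by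
      have hsum : (fun y => ∑ t, ψ c a y p t * φ a i y t q) =
          ∑ t, fun y => ψ c a y p t * φ a i y t q := by
        ext y
        simp
      rw [hsum]
      refine MDifferentiableAt.sum fun t _ => ?_
      refine MDifferentiableAt.mul ?_ ?_
      · exact (hψ.holomorphic c a p t).mdifferentiableAt
          (((G.isOpen_U c).inter (F.isOpen_U a)).mem_nhds ⟨hx.1, ha⟩)
      · exact (hφ.holomorphic a i t q).mdifferentiableAt
          (((F.isOpen_U a).inter (E.isOpen_U i)).mem_nhds ⟨ha, hx.2⟩)
    refine key.congr_of_eventuallyEq ?_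
    filter_upwards [hn] with y hy
    rw [hφ.comp_eq hψ hy.1.1 hy.1.2 (F.mem_idx y) hy.2, Matrix.mul_apply]
  compat c c' i j x hx := by
    have ha := F.mem_idx x
    have h1 := hφ.compat (F.idx x) (F.idx x) i j x ⟨⟨ha, ha⟩, hx.2⟩
    have h2 := hψ.compat c c' (F.idx x) (F.idx x) x ⟨hx.1, ha, ha⟩
    rw [F.g_self _ x ha, Matrix.one_mul] at h1
    rw [F.g_self _ x ha, Matrix.mul_one] at h2
    rw [Matrix.mul_assoc, h1, h2, Matrix.mul_assoc]

theorem IsIso.refl (E : HolBundle X n) : IsIso E E :=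
  ⟨E.g, E.g, IsHom.id E, IsHom.id E, fun a i x hx => by
    rw [E.g_mul a i a x ⟨hx, hx.1⟩, E.g_mul i a i x ⟨⟨hx.2, hx.1⟩, hx.2⟩, E.g_self a x hx.1,
      E.g_self i x hx.2]
    exact ⟨rfl, rfl⟩⟩

theorem IsIso.symm {E : HolBundle X n} {F : HolBundle X m} (h : IsIso E F) : IsIso F E := by
  obtain ⟨φ, ψ, hφ, hψ, h⟩ := h
  exact ⟨ψ, φ, hψ, hφ, fun i a x hx => (h a i x hx.symm).symm⟩

theorem IsIso.trans {E : HolBundle X n} {F : HolBundle X m} {G : HolBundle X l}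
    (h : IsIso E F) (h' : IsIso F G) : IsIso E G := by
  obtain ⟨φ, ψ, hφ, hψ, h⟩ := h
  obtain ⟨φ', ψ', hφ', hψ', h'⟩ := h'
  refine ⟨_, _, hφ.comp hφ', hψ'.comp hψ, fun c i x hx => ?_⟩
  have ha := F.mem_idx x
  obtain ⟨h1, h2⟩ := h _ i x ⟨ha, hx.2⟩
  obtain ⟨h3, h4⟩ := h' c _ x ⟨hx.1, ha⟩
  constructor
  · rw [Matrix.mul_assoc, ← Matrix.mul_assoc (φ _ i x), h1, Matrix.one_mul, h3]
  · rw [Matrix.mul_assoc, ← Matrix.mul_assoc (ψ' _ c x), h4, Matrix.one_mul, h2]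

end HolBundle

section ModuliSpace

variable (X : Type u) [TopologicalSpace X] [ChartedSpace ℂ X]

/-- The stable holomorphic vector bundles of rank `r` and degree `d` on `X`. -/
abbrev StableBundle (r : ℕ) (d : ℤ) :=
  {E : HolBundle X (Fin r) // HolBundle.IsStable E ∧ HolBundle.HasDegree E d}

/-- Isomorphism of stable holomorphic vector bundles. -/
instance stableBundleSetoid (r : ℕ) (d : ℤ) : Setoid (StableBundle X r d) where
  r E F := HolBundle.IsIso E.1 F.1
  iseqv := ⟨fun E => HolBundle.IsIso.refl E.1, HolBundle.IsIso.symm, HolBundle.IsIso.trans⟩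

/-- The moduli space `M_X(r, d)`: the isomorphism classes of stable holomorphic vector bundles of
rank `r` and degree `d` on `X`. -/
def ModuliSpace (r : ℕ) (d : ℤ) : Type (u + 1) := Quotient (stableBundleSetoid X r d)

variable {X}

/-- The isomorphism class of a stable bundle, as a point of the moduli space. -/
def ModuliSpace.mk {r : ℕ} {d : ℤ} (E : HolBundle X (Fin r)) (hE : HolBundle.IsStable E)
    (hd : HolBundle.HasDegree E d) : ModuliSpace X r d :=
  Quotient.mk (stableBundleSetoid X r d) ⟨E, hE, hd⟩

/-- A holomorphic family of vector bundles of rank `r` on `X`, parametrized by the subset `T` of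
`ℂᵐ`: a holomorphic vector bundle on `X × T`. -/
abbrev HolFamily (X : Type u) [TopologicalSpace X] [ChartedSpace ℂ X] (r : ℕ) {m : ℕ}
    (T : Set (Fin m → ℂ)) :=
  HolBundleOn (𝓘(ℂ).prod 𝓘(ℂ, Fin m → ℂ)) ((univ : Set X) ×ˢ T) (Fin r)

/-- The member of a family over the parameter `t`: the restriction of the bundle to `X × {t}`. -/
def HolFamily.fiber {r m : ℕ} {T : Set (Fin m → ℂ)} (W : HolFamily X r T) (t : Fin m → ℂ)
    (ht : t ∈ T) : HolBundle X (Fin r) where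
  ι := W.ι
  U i := {x | (x, t) ∈ W.U i}
  isOpen_U i := (W.isOpen_U i).preimage (Continuous.prodMk_left t)
  cover x _ := W.cover (x, t) ⟨mem_univ x, ht⟩
  g i j x := W.g i j (x, t)
  holomorphic_g i j p q := by
    have h : MDifferentiable 𝓘(ℂ) (𝓘(ℂ).prod 𝓘(ℂ, Fin m → ℂ)) (fun x : X => (x, t)) :=
      mdifferentiable_id.prodMk mdifferentiable_const
    exact (W.holomorphic_g i j p q).comp h.mdifferentiableOn fun x hx => hx
  g_self i x hx := W.g_self i (x, t) hx
  g_mul i j k x hx := W.g_mul i j k (x, t) hx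

/-- The map `p` from the open subset `T` of `ℂᵐ` to the moduli space is holomorphic, for the complex
structure that makes it a moduli space: locally on `T`, it is the classifying map of a
holomorphic family of stable vector bundles. -/
def ModuliSpace.IsHolomorphicOn {r : ℕ} {d : ℤ} {m : ℕ} (p : (Fin m → ℂ) → ModuliSpace X r d)
    (T : Set (Fin m → ℂ)) : Prop :=
  ∀ t₀ ∈ T, ∃ T' : Set (Fin m → ℂ), IsOpen T' ∧ t₀ ∈ T' ∧ T' ⊆ T ∧
    ∃ W : HolFamily X r T', ∀ (t : Fin m → ℂ) (ht : t ∈ T'),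
      ∃ (hs : HolBundle.IsStable (W.fiber t ht)) (hd : HolBundle.HasDegree (W.fiber t ht) d),
        p t = ModuliSpace.mk (W.fiber t ht) hs hd

/-- A holomorphic transformation of the moduli space: it carries holomorphic maps from open subsets
of `ℂᵐ` to holomorphic maps. -/
def ModuliSpace.IsHolomorphicSelfMap {r : ℕ} {d : ℤ}
    (f : ModuliSpace X r d → ModuliSpace X r d) : Prop :=
  ∀ (m : ℕ) (T : Set (Fin m → ℂ)) (p : (Fin m → ℂ) → ModuliSpace X r d), IsOpen T →
    ModuliSpace.IsHolomorphicOn p T → ModuliSpace.IsHolomorphicOn (fun t => f (p t)) T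

/-- An anti-holomorphic transformation of the moduli space: it carries holomorphic maps from open
subsets of `ℂᵐ` to anti-holomorphic maps, that is to maps which become holomorphic, on the complex
conjugate open set, once they are composed with `t ↦ conj t`. -/
def ModuliSpace.IsAntiholomorphicSelfMap {r : ℕ} {d : ℤ}
    (f : ModuliSpace X r d → ModuliSpace X r d) : Prop :=
  ∀ (m : ℕ) (T : Set (Fin m → ℂ)) (p : (Fin m → ℂ) → ModuliSpace X r d), IsOpen T →
    ModuliSpace.IsHolomorphicOn p T →
      ModuliSpace.IsHolomorphicOn (fun t => f (p (star t))) {t | star t ∈ T}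

end ModuliSpace

/-! ### Complex conjugation on `ℂ`: orders of meromorphic functions, failure of holomorphy -/

section Conjugation

/-! Write `θ_σ` for `autTwist σ`, the identity or complex conjugation. Everything rests on the fact
that `φ ↦ θ_σ ∘ φ ∘ σ⁻¹` is a ring homomorphism that preserves holomorphy, and that `σ ↦ θ_σ` is
multiplicative because a non-empty Riemann surface has no map in `AutPM` that is both holomorphic
and anti-holomorphic.

Applied entrywise to matrices, this operation commutes with products, transposes, Kronecker products
and determinants, and preserves fibrewise injectivity. So it carries bundles, homomorphisms,
isomorphisms, sub-bundles and `F* ⊗ E` to objects of the same kind. Applied to a meromorphic section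
of `det E`, it moves the divisor by `σ` without changing multiplicities
(`meromorphicOrderAt_autTwist`): in local coordinates one conjugates in source and target, if at
all, and composes with a germ of biholomorphism. Hence degrees are preserved (`HasDegree.act`). The
sub-bundles of `σ(E)` are the `σ(F)` for sub-bundles `F` of `E`, and the degree of `F* ⊗ E` is
unchanged, so stability is preserved too.

For the complex structure, apply the same recipe to a bundle on `X × T`, with `(σ⁻¹, κ)` in place of
`σ⁻¹`. Here `κ` is the identity if `σ` is holomorphic and conjugation of the parameters if `σ` is
anti-holomorphic, since conjugating values requires conjugating all the variables. The fibre over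
`t` of the new family is `σ` applied to the fibre over `κ t` (`HolFamily.act_fiber`). -/

/-- The order of a meromorphic function is unchanged under conjugation in source and target. -/
theorem MeromorphicAt.conj_conj {f : ℂ → ℂ} {a : ℂ} {n : ℤ} (hf : MeromorphicAt f a)
    (hn : meromorphicOrderAt f a = n) :
    MeromorphicAt (conj ∘ f ∘ conj) (conj a) ∧
      meromorphicOrderAt (conj ∘ f ∘ conj) (conj a) = n := by
  obtain ⟨g, hg, hg0, hfg⟩ := (meromorphicOrderAt_eq_int_iff hf).1 hn
  have htends : Filter.Tendsto (conj : ℂ → ℂ) (𝓝 (conj a)) (𝓝 a) := by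
    simpa using (Complex.continuous_conj.tendsto (conj a))
  have hg' : AnalyticAt ℂ (conj ∘ g ∘ conj) (conj a) := by
    rw [Complex.analyticAt_iff_eventually_differentiableAt] at hg ⊢
    filter_upwards [htends.eventually hg] with z hz
    simpa using hz.conj_conj
  -- The order is read off the factorization `(z - a) ^ n • g` with `g a ≠ 0`. Conjugating in source
  -- and target gives such a factorization at `conj a`, with the same exponent.
  have hfg' : ∀ᶠ z in 𝓝[≠] (conj a),
      (conj ∘ f ∘ conj) z = (z - conj a) ^ n • (conj ∘ g ∘ conj) z := by
    rw [eventually_nhdsWithin_iff] at hfg ⊢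
    filter_upwards [htends.eventually hfg] with z hz hza
    have hne : conj z ∈ ({a} : Set ℂ)ᶜ := fun h => hza (by
      rw [mem_singleton_iff] at h ⊢
      rw [← h, Complex.conj_conj])
    simp [hz hne, map_zpow₀]
  have hmer : MeromorphicAt (conj ∘ f ∘ conj) (conj a) := by
    refine MeromorphicAt.congr ?_ (Filter.EventuallyEq.symm hfg')
    exact (((MeromorphicAt.id _).sub (MeromorphicAt.const _ _)).zpow n).smul hg'.meromorphicAt
  exact ⟨hmer, (meromorphicOrderAt_eq_int_iff hmer).2 ⟨_, hg', by simpa using hg0, hfg'⟩⟩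

/-- A complex derivative `c` would have to equal `1` along the real direction and satisfy `c * I =
-I` along the imaginary one. -/
theorem Complex.not_differentiableAt_conj (a : ℂ) :
    ¬ DifferentiableAt ℂ (conj : ℂ → ℂ) a := by
  intro h
  have h1 : HasDerivAt (fun t : ℝ => conj (a + t)) (deriv conj a) 0 := by
    have hc : HasDerivAt (fun t : ℝ => a + (t : ℂ)) 1 0 :=
      (Complex.ofRealCLM.hasDerivAt (x := 0)).const_add a
    have h' : HasDerivAt conj (deriv conj a) (a + ((0 : ℝ) : ℂ)) := by simpa using h.hasDerivAt
    simpa only [mul_one, Function.comp_def] using h'.comp_of_eq (0 : ℝ) hc (by simp)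
  have h2 : HasDerivAt (fun t : ℝ => conj (a + t * Complex.I))
      (deriv conj a * Complex.I) 0 := by
    have hc : HasDerivAt (fun t : ℝ => a + (t : ℂ) * Complex.I) Complex.I 0 := by
      simpa using ((Complex.ofRealCLM.hasDerivAt (x := 0)).mul_const Complex.I).const_add a
    have h' : HasDerivAt conj (deriv conj a) (a + ((0 : ℝ) : ℂ) * Complex.I) := by
      simpa using h.hasDerivAt
    exact h'.comp_of_eq (0 : ℝ) hc (by simp)
  have h3 : HasDerivAt (fun t : ℝ => conj (a + t)) 1 0 := by
    simpa using (Complex.ofRealCLM.hasDerivAt (x := 0)).const_add (conj a)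
  have h4 : HasDerivAt (fun t : ℝ => conj (a + t * Complex.I)) (-Complex.I) 0 := by
    simpa using ((Complex.ofRealCLM.hasDerivAt (x := 0)).mul_const (-Complex.I)).const_add (conj a)
  have h5 := h1.unique h3
  have h6 := h2.unique h4
  rw [h5, one_mul] at h6
  have := congrArg Complex.im h6
  norm_num at this

end Conjugation

/-! ### The twist `θ_σ` and its effect on local expressions -/

section Automorphisms

variable {X : Type u} [TopologicalSpace X] [ChartedSpace ℂ X] [IsManifold 𝓘(ℂ) ω X]

/-- The identity of a non-empty Riemann surface is not anti-holomorphic. -/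
theorem not_isAntiholomorphic_id [Nonempty X] : ¬ IsAntiholomorphic (id : X → X) := by
  intro h
  obtain ⟨x⟩ := ‹Nonempty X›
  have : IsManifold 𝓘(ℂ) 1 X := IsManifold.of_le (n := ω) le_top
  set e := chartAt ℂ x with he
  have hx : x ∈ e.source := mem_chart_source ℂ x
  have h1 : MDifferentiableAt 𝓘(ℂ) 𝓘(ℂ) ((fun y => conj (e y)) ∘ e.symm) (e x) := by
    refine MDifferentiableAt.comp (I' := 𝓘(ℂ)) _ ?_
      (mdifferentiableAt_atlas_symm (chart_mem_atlas ℂ x) (e.map_source hx))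
    rw [e.left_inv hx]
    exact h.2 x
  refine Complex.not_differentiableAt_conj (e x) ?_
  refine (mdifferentiableAt_iff_differentiableAt.1 h1).congr_of_eventuallyEq ?_
  filter_upwards [e.open_target.mem_nhds (e.map_source hx)] with z hz
  simp [e.right_inv hz]

theorem autTwist_of_holomorphic {σ : AutPM X} (h : MDifferentiable 𝓘(ℂ) 𝓘(ℂ) (σ.1 : X → X)) :
    autTwist σ = RingHom.id ℂ := if_pos h

/-- Otherwise composing `σ` with its inverse, whichever type the inverse has, would make the
identity anti-holomorphic. This is what makes the case distinction in `autTwist` give conjugation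
for every anti-holomorphic `σ`. -/
theorem not_holomorphic_of_isAntiholomorphic [Nonempty X] {σ : AutPM X}
    (h : IsAntiholomorphic (σ.1 : X → X)) : ¬ MDifferentiable 𝓘(ℂ) 𝓘(ℂ) (σ.1 : X → X) := by
  intro k
  refine not_isAntiholomorphic_id (X := X) ?_
  rcases σ.2 with ⟨_, k'⟩ | ⟨_, h'⟩
  · simpa [Function.comp_def, Function.id_def] using h.comp_holomorphic k'
  · simpa [Function.comp_def, Function.id_def] using h'.comp_holomorphic k

theorem autTwist_of_isAntiholomorphic [Nonempty X] {σ : AutPM X}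
    (h : IsAntiholomorphic (σ.1 : X → X)) : autTwist σ = starRingEnd ℂ :=
  if_neg (not_holomorphic_of_isAntiholomorphic h)

theorem holomorphic_or_isAntiholomorphic (σ : AutPM X) :
    MDifferentiable 𝓘(ℂ) 𝓘(ℂ) (σ.1 : X → X) ∨ IsAntiholomorphic (σ.1 : X → X) :=
  σ.2.imp And.left And.left

theorem autTwist_one : autTwist (1 : AutPM X) = RingHom.id ℂ :=
  autTwist_of_holomorphic mdifferentiable_id

theorem autTwist_mul [Nonempty X] (σ τ : AutPM X) :
    autTwist (σ * τ) = (autTwist σ).comp (autTwist τ) := by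
  rcases holomorphic_or_isAntiholomorphic σ with h | h <;>
  rcases holomorphic_or_isAntiholomorphic τ with k | k
  · rw [autTwist_of_holomorphic h, autTwist_of_holomorphic k,
      autTwist_of_holomorphic (σ := σ * τ) (h.comp k)]
    rfl
  · have hστ : IsAntiholomorphic (σ.1 ∘ τ.1) := IsAntiholomorphic.holomorphic_comp h k
    rw [autTwist_of_holomorphic h, autTwist_of_isAntiholomorphic k,
      autTwist_of_isAntiholomorphic (σ := σ * τ) hστ]
    rfl
  · rw [autTwist_of_isAntiholomorphic h, autTwist_of_holomorphic k,
      autTwist_of_isAntiholomorphic (σ := σ * τ) (h.comp_holomorphic k)]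
    rfl
  · rw [autTwist_of_isAntiholomorphic h, autTwist_of_isAntiholomorphic k,
      autTwist_of_holomorphic (σ := σ * τ) (h.comp k)]
    ext z
    simp

theorem autTwist_eq (σ : AutPM X) :
    autTwist σ = RingHom.id ℂ ∨ autTwist σ = starRingEnd ℂ := by
  unfold autTwist
  split_ifs <;> simp

@[simp]
theorem autTwist_autTwist (σ : AutPM X) (z : ℂ) : autTwist σ (autTwist σ z) = z := by
  rcases autTwist_eq σ with h | h <;> simp [h]

theorem autTwist_inv [Nonempty X] (σ : AutPM X) : autTwist σ⁻¹ = autTwist σ := by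
  have h := autTwist_mul σ σ⁻¹
  rw [mul_inv_cancel, autTwist_one] at h
  ext z
  rw [← autTwist_autTwist σ (autTwist σ⁻¹ z)]
  exact congrArg (autTwist σ) (RingHom.congr_fun h z).symm

theorem DifferentiableAt.autTwist_comp (σ : AutPM X) {f : ℂ → ℂ} {a : ℂ}
    (hf : DifferentiableAt ℂ f a) :
    DifferentiableAt ℂ (autTwist σ ∘ f ∘ autTwist σ) (autTwist σ a) := by
  rcases autTwist_eq σ with h | h <;> rw [h]
  · exact hf
  · exact hf.conj_conj

theorem MeromorphicAt.autTwist_comp (σ : AutPM X) {f : ℂ → ℂ} {a : ℂ} {n : ℤ}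
    (hf : MeromorphicAt f a) (hn : meromorphicOrderAt f a = n) :
    MeromorphicAt (autTwist σ ∘ f ∘ autTwist σ) (autTwist σ a) ∧
      meromorphicOrderAt (autTwist σ ∘ f ∘ autTwist σ) (autTwist σ a) = n := by
  rcases autTwist_eq σ with h | h <;> rw [h]
  · exact ⟨hf, hn⟩
  · exact hf.conj_conj hn

/-- The expression of `θ_σ ∘ φ ∘ σ⁻¹` in a chart is differentiable where that of `φ` is. -/
theorem differentiableAt_autTwist_chart (σ : AutPM X) (y₀ : X) {φ : X → ℂ} {z : ℂ}
    (hz : z ∈ (chartAt ℂ y₀).target)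
    (hφ : MDifferentiableAt 𝓘(ℂ) 𝓘(ℂ) φ (σ.1.symm ((chartAt ℂ y₀).symm z))) :
    DifferentiableAt ℂ
      (fun w => autTwist σ (φ (σ.1.symm ((chartAt ℂ y₀).symm w)))) z := by
  have : IsManifold 𝓘(ℂ) 1 X := IsManifold.of_le (n := ω) le_top
  exact mdifferentiableAt_iff_differentiableAt.1
    ((mdifferentiableAt_autTwist σ hφ).comp (I' := 𝓘(ℂ)) z
      (mdifferentiableAt_atlas_symm (chart_mem_atlas ℂ y₀) hz))

/-- In the charts at `σ⁻¹ y` and `y`, the function `θ_σ ∘ f ∘ σ⁻¹` has at `y` the same order as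
`f` at `σ⁻¹ y`. -/
theorem meromorphicOrderAt_autTwist [Nonempty X] (σ : AutPM X) {f : X → ℂ} {y : X} {n : ℤ}
    (hf : MeromorphicAt (f ∘ (chartAt ℂ (σ.1.symm y)).symm)
      (chartAt ℂ (σ.1.symm y) (σ.1.symm y)))
    (hn : meromorphicOrderAt (f ∘ (chartAt ℂ (σ.1.symm y)).symm)
      (chartAt ℂ (σ.1.symm y) (σ.1.symm y)) = n) :
    MeromorphicAt ((fun z => autTwist σ (f (σ.1.symm z))) ∘ (chartAt ℂ y).symm)
      (chartAt ℂ y y) ∧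
    meromorphicOrderAt ((fun z => autTwist σ (f (σ.1.symm z))) ∘ (chartAt ℂ y).symm)
      (chartAt ℂ y y) = n := by
  have : IsManifold 𝓘(ℂ) 1 X := IsManifold.of_le (n := ω) le_top
  set x := σ.1.symm y with hxdef
  have hσx : σ.1 x = y := σ.1.apply_symm_apply y
  set e := chartAt ℂ y with he
  set c := chartAt ℂ x with hc
  have hy : y ∈ e.source := mem_chart_source ℂ y
  have hx : x ∈ c.source := mem_chart_source ℂ x
  have hey : e.symm (e y) = y := e.left_inv hy
  have hcx : c.symm (c x) = x := c.left_inv hx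
  -- `h` is the coordinate expression of `σ⁻¹` followed by the twist, which makes it holomorphic;
  -- `k` is the analogue for `σ`. Up to conjugation by `θ_σ`, `k` is a local left inverse of `h`,
  -- and it serves only to show that `h` has non-zero derivative.
  set h : ℂ → ℂ := fun w => autTwist σ (c (σ.1.symm (e.symm w))) with hh
  set k : ℂ → ℂ := fun w => autTwist σ (e (σ.1 (c.symm w))) with hk
  have hmem : ∀ᶠ w in 𝓝 (e y), w ∈ e.target ∧ σ.1.symm (e.symm w) ∈ c.source := by
    refine Filter.Eventually.and (e.open_target.mem_nhds (e.map_source hy)) ?_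
    have hcont : ContinuousAt (fun w => σ.1.symm (e.symm w)) (e y) :=
      σ.1.symm.continuous.continuousAt.comp (e.continuousAt_symm (e.map_source hy))
    refine hcont.preimage_mem_nhds (c.open_source.mem_nhds ?_)
    rw [hey]
    exact hx
  have hhan : AnalyticAt ℂ h (e y) := by
    rw [Complex.analyticAt_iff_eventually_differentiableAt]
    filter_upwards [hmem] with w hw
    exact differentiableAt_autTwist_chart σ y hw.1
      (mdifferentiableAt_atlas (chart_mem_atlas ℂ x) hw.2)
  have hhy : h (e y) = autTwist σ (c x) := by simp only [hh, hey, ← hxdef]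
  have hkd : DifferentiableAt ℂ k (c x) := by
    have := differentiableAt_autTwist_chart σ⁻¹ x (φ := e) (c.map_source hx) (by
      rw [← hc, hcx]
      change MDifferentiableAt 𝓘(ℂ) 𝓘(ℂ) e (σ.1 x)
      rw [hσx]
      exact mdifferentiableAt_atlas (chart_mem_atlas ℂ y) hy)
    rw [autTwist_inv] at this
    exact this
  have hkd' := hkd.autTwist_comp σ
  rw [← hhy] at hkd'
  have hcomp : (autTwist σ ∘ k ∘ autTwist σ) ∘ h =ᶠ[𝓝 (e y)] id := by
    filter_upwards [hmem] with w hw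
    simp [hh, hk, c.left_inv hw.2, e.right_inv hw.1]
  -- The chain rule for the left inverse would give the identity derivative `0`.
  have hderiv : deriv h (e y) ≠ 0 := by
    intro h0
    have h1 := hkd'.hasDerivAt.comp (e y) hhan.differentiableAt.hasDerivAt
    rw [h0, mul_zero] at h1
    exact zero_ne_one (h1.unique ((hasDerivAt_id (e y)).congr_of_eventuallyEq hcomp))
  obtain ⟨hm, ho⟩ := hf.autTwist_comp σ hn
  rw [← hhy] at hm ho
  -- The two inner twists cancel, so the transformed function is `θ_σ ∘ (f in its chart) ∘ θ_σ`, of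
  -- known order, precomposed with `h`, which is unramified and so preserves the order.
  have heq : (autTwist σ ∘ (f ∘ c.symm) ∘ autTwist σ) ∘ h =ᶠ[𝓝 (e y)]
      (fun z => autTwist σ (f (σ.1.symm z))) ∘ e.symm := by
    filter_upwards [hmem] with w hw
    simp [hh, c.left_inv hw.2]
  have heq' := heq.filter_mono (nhdsWithin_le_nhds (s := {e y}ᶜ))
  refine ⟨(hm.comp_analyticAt hhan).congr heq', ?_⟩
  rw [← meromorphicOrderAt_congr heq', meromorphicOrderAt_comp_of_deriv_ne_zero hhan hderiv, ho]

end Automorphisms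

/-! ### Transport of bundles, degrees and stability by `σ` -/

namespace HolBundle

variable {X : Type u} [TopologicalSpace X] [ChartedSpace ℂ X]
variable {m n : Type} [Fintype m] [DecidableEq m] [Fintype n] [DecidableEq n]

/-- Two bundles with the same cover, indexed in the same way, and the same cocycle are equal. -/
theorem ext_of_eq {V : Type*} [NormedAddCommGroup V] [NormedSpace ℂ V] {H : Type*}
    [TopologicalSpace H] {I : ModelWithCorners ℂ V H} {M : Type u} [TopologicalSpace M]
    [ChartedSpace H M] {S : Set M} {ι : Type u} {U U' : ι → Set M}
    {g g' : ι → ι → M → Matrix n n ℂ} {h1 h2 h3 h4 h5 k1 k2 k3 k4 k5}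
    (hU : U = U') (hg : g = g') :
    (⟨ι, U, h1, h2, g, h3, h4, h5⟩ : HolBundleOn I S n) = ⟨ι, U', k1, k2, g', k3, k4, k5⟩ := by
  subst hU hg
  rfl

variable [IsManifold 𝓘(ℂ) ω X]

/-- Since `HolBundle.act` keeps the index type of the cover, the group laws hold as equalities of
cocycles and not only up to isomorphism. -/
theorem act_one (E : HolBundle X n) : act 1 E = E := by
  refine ext_of_eq ?_ ?_
  · funext i
    exact image_id _
  · funext i j x
    rw [autTwist_one]
    rfl

theorem act_mul [Nonempty X] (σ τ : AutPM X) (E : HolBundle X n) :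
    act (σ * τ) E = act σ (act τ E) := by
  refine ext_of_eq ?_ ?_
  · funext i
    exact image_comp σ.1 τ.1 _
  · funext i j x
    rw [autTwist_mul]
    rfl

theorem act_inv_act [Nonempty X] (σ : AutPM X) (E : HolBundle X n) :
    act σ⁻¹ (act σ E) = E := by
  rw [← act_mul, inv_mul_cancel, act_one]

theorem act_act_inv [Nonempty X] (σ : AutPM X) (E : HolBundle X n) :
    act σ (act σ⁻¹ E) = E := by
  rw [← act_mul, mul_inv_cancel, act_one]

/-- `θ_σ` is a ring homomorphism applied entrywise, and images under the bijection `σ` commute with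
intersections. This lets a degree computed for `E` be reused for `σ(E)` in the stability condition.
-/
theorem act_tensor_dual (σ : AutPM X) (F : HolBundle X m) (E : HolBundle X n) :
    act σ (tensor (dual F) E) = tensor (dual (act σ F)) (act σ E) := by
  refine ext_of_eq ?_ ?_
  · funext i
    exact image_inter σ.1.injective
  · funext i j x
    ext p q
    simp [dual, tensor, act]

theorem IsHom.act {F : HolBundle X m} {E : HolBundle X n} {φ : E.ι → F.ι → X → Matrix n m ℂ}
    (h : IsHom F E φ) (σ : AutPM X) :
    IsHom (act σ F) (act σ E) (fun i a x => (φ i a (σ.1.symm x)).map (autTwist σ)) where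
  holomorphic i a p q := by
    rintro _ ⟨⟨x, hx, rfl⟩, ⟨y, hy, hxy⟩⟩
    obtain rfl := σ.1.injective hxy
    refine MDifferentiableAt.mdifferentiableWithinAt ?_
    refine mdifferentiableAt_autTwist σ (φ := fun x => φ i a x p q) ?_
    rw [σ.1.symm_apply_apply]
    exact (h.holomorphic i a p q).mdifferentiableAt
      (((E.isOpen_U i).inter (F.isOpen_U a)).mem_nhds ⟨hx, hy⟩)
  compat i j a b := by
    rintro _ ⟨⟨⟨x, hx, rfl⟩, ⟨y, hy, hxy⟩⟩, ⟨⟨z, hz, hxz⟩, ⟨w, hw, hxw⟩⟩⟩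
    obtain rfl := σ.1.injective hxy
    obtain rfl := σ.1.injective hxz
    obtain rfl := σ.1.injective hxw
    simp only [HolBundle.act]
    rw [σ.1.symm_apply_apply, ← Matrix.map_mul, ← Matrix.map_mul,
      h.compat i j a b _ ⟨⟨hx, hy⟩, hz, hw⟩]

theorem IsSubbundle.act {F : HolBundle X m} {E : HolBundle X n} (h : IsSubbundle F E)
    (σ : AutPM X) : IsSubbundle (act σ F) (act σ E) := by
  obtain ⟨φ, hφ, hinj⟩ := h
  refine ⟨_, hφ.act σ, ?_⟩
  rintro i a _ ⟨⟨x, hx, rfl⟩, ⟨y, hy, hxy⟩⟩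
  obtain rfl := σ.1.injective hxy
  rw [σ.1.symm_apply_apply]
  -- The twisted matrix is `θ_σ ∘ M ∘ θ_σ` as a map on vectors, because `θ_σ` is an involution;
  -- injectivity then passes from `M` through two injective maps.
  have key : ∀ v : m → ℂ, ((φ i a y).map (autTwist σ)).mulVec v =
      autTwist σ ∘ (φ i a y).mulVec (autTwist σ ∘ v) := by
    intro v
    funext p
    rw [Function.comp_apply, RingHom.map_mulVec]
    congr 2
    funext q
    simp
  have hθ : Function.Injective (autTwist σ) :=
    Function.LeftInverse.injective (autTwist_autTwist σ)
  intro v w hvw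
  simp only [key] at hvw
  exact hθ.comp_left (hinj i a y ⟨hx, hy⟩ (hθ.comp_left hvw))

theorem IsIso.act {E : HolBundle X n} {F : HolBundle X m} (h : IsIso E F) (σ : AutPM X) :
    IsIso (act σ E) (act σ F) := by
  obtain ⟨φ, ψ, hφ, hψ, h⟩ := h
  refine ⟨_, _, hφ.act σ, hψ.act σ, ?_⟩
  rintro a i _ ⟨⟨x, hx, rfl⟩, ⟨y, hy, hxy⟩⟩
  obtain rfl := σ.1.injective hxy
  rw [σ.1.symm_apply_apply, ← Matrix.map_mul, ← Matrix.map_mul, (h a i y ⟨hx, hy⟩).1,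
    (h a i y ⟨hx, hy⟩).2]
  simp

/-- The section `θ_σ ∘ s ∘ σ⁻¹` has divisor `D ∘ σ⁻¹`, and reindexing by the bijection `σ⁻¹` leaves
the sum of the multiplicities unchanged. -/
theorem HasDegree.act [Nonempty X] {E : HolBundle X n} {d : ℤ} (h : HasDegree E d)
    (σ : AutPM X) : HasDegree (act σ E) d := by
  obtain ⟨s, D, hs, hD, hfin, hsum⟩ := h
  refine ⟨fun i y => autTwist σ (s i (σ.1.symm y)), fun y => D (σ.1.symm y), ?_, ?_, ?_, ?_⟩
  · rintro i j _ ⟨⟨x, hx, rfl⟩, ⟨y, hy, hxy⟩⟩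
    obtain rfl := σ.1.injective hxy
    simp only [HolBundle.act, σ.1.symm_apply_apply]
    rw [hs i j y ⟨hx, hy⟩, map_mul, RingHom.map_det]
    rfl
  · rintro i _ ⟨x, hx, rfl⟩
    have hx' : σ.1.symm (σ.1 x) ∈ E.U i := by rwa [σ.1.symm_apply_apply]
    exact meromorphicOrderAt_autTwist σ (hD i _ hx').1 (hD i _ hx').2
  · exact hfin.preimage σ.1.symm.injective.injOn
  · rw [← hsum]
    exact finsum_comp_equiv σ.1.symm.toEquiv

theorem IsStable.act [Nonempty X] {r : ℕ} {E : HolBundle X (Fin r)} (h : IsStable E)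
    (σ : AutPM X) : IsStable (act σ E) := by
  intro k F hk hkr hF
  -- Test sub-bundles of `σ(E)` are brought back to `E` by `σ⁻¹`, with the same rank; the degree
  -- obtained there is then transported forward by `σ`.
  have hF' := hF.act σ⁻¹
  rw [act_inv_act] at hF'
  obtain ⟨d, hd, hpos⟩ := h k _ hk hkr hF'
  have hd' := hd.act σ
  rw [act_tensor_dual, act_act_inv] at hd'
  exact ⟨d, hd', hpos⟩

theorem isStable_act_iff [Nonempty X] {r : ℕ} {E : HolBundle X (Fin r)} (σ : AutPM X) :
    IsStable (act σ E) ↔ IsStable E := by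
  refine ⟨fun h => ?_, fun h => h.act σ⟩
  simpa only [act_inv_act] using h.act σ⁻¹

end HolBundle

/-! ### Transport of holomorphic families over parameter spaces -/

section Families

variable {X : Type u} [TopologicalSpace X] [ChartedSpace ℂ X] [IsManifold 𝓘(ℂ) ω X]

theorem mdifferentiableAt_autTwist_prod {m : ℕ} {σ : AutPM X}
    (hσ : MDifferentiable 𝓘(ℂ) 𝓘(ℂ) (σ.1 : X → X)) {φ : X × (Fin m → ℂ) → ℂ}
    {z : X × (Fin m → ℂ)}
    (hφ : MDifferentiableAt (𝓘(ℂ).prod 𝓘(ℂ, Fin m → ℂ)) 𝓘(ℂ) φ (σ.1.symm z.1, z.2)) :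
    MDifferentiableAt (𝓘(ℂ).prod 𝓘(ℂ, Fin m → ℂ)) 𝓘(ℂ)
      (fun y : X × (Fin m → ℂ) => autTwist σ (φ (σ.1.symm y.1, y.2))) z := by
  have h' : MDifferentiable 𝓘(ℂ) 𝓘(ℂ) (σ.1.symm : X → X) := by
    have : Nonempty X := ⟨z.1⟩
    rcases σ.2 with ⟨_, k⟩ | ⟨k, _⟩
    · exact k
    · exact absurd hσ (not_holomorphic_of_isAntiholomorphic k)
  rw [autTwist_of_holomorphic hσ]
  exact MDifferentiableAt.comp (I' := 𝓘(ℂ).prod 𝓘(ℂ, Fin m → ℂ)) (g := φ)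
    (f := fun y : X × (Fin m → ℂ) => (σ.1.symm y.1, y.2)) z hφ
    (((h' _).comp z mdifferentiableAt_fst).prodMk mdifferentiableAt_snd)

/-- Precomposing a holomorphic function on `X × ℂᵐ` with an anti-holomorphic map on both factors
and conjugating gives a holomorphic function. -/
theorem IsAntiholomorphic.conj_comp_prod {m : ℕ} {f : X → X} (hf : IsAntiholomorphic f)
    {φ : X × (Fin m → ℂ) → ℂ} {z : X × (Fin m → ℂ)}
    (hφ : MDifferentiableAt (𝓘(ℂ).prod 𝓘(ℂ, Fin m → ℂ)) 𝓘(ℂ) φ (f z.1, star z.2)) :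
    MDifferentiableAt (𝓘(ℂ).prod 𝓘(ℂ, Fin m → ℂ)) 𝓘(ℂ)
      (fun y : X × (Fin m → ℂ) => conj (φ (f y.1, star y.2))) z := by
  have : IsManifold 𝓘(ℂ) 1 X := IsManifold.of_le (n := ω) le_top
  set e := chartAt ℂ (f z.1) with he
  have hsrc : f z.1 ∈ e.source := mem_chart_source ℂ (f z.1)
  -- Reading only the `X` factor in a chart turns `φ` into a function on the vector space `ℂ × ℂᵐ`,
  -- where conjugation in source and target is available. The outer map `(y, t) ↦ (conj (e (f y)),
  -- t)` is holomorphic, and composing with it gives back `conj (φ (f y, star t))` near `z`.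
  have h1 : MDifferentiableAt (𝓘(ℂ).prod 𝓘(ℂ, Fin m → ℂ)) 𝓘(ℂ)
      (fun w : ℂ × (Fin m → ℂ) => φ (e.symm w.1, w.2)) (e (f z.1), star z.2) := by
    refine MDifferentiableAt.comp (I' := 𝓘(ℂ).prod 𝓘(ℂ, Fin m → ℂ)) (g := φ)
      (f := fun w : ℂ × (Fin m → ℂ) => (e.symm w.1, w.2)) _ ?_ ?_
    · simpa only [e.left_inv hsrc] using hφ
    · refine MDifferentiableAt.prodMk ?_ mdifferentiableAt_snd
      exact MDifferentiableAt.comp (I' := 𝓘(ℂ)) (g := e.symm)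
        (f := fun w : ℂ × (Fin m → ℂ) => w.1) _
        (mdifferentiableAt_atlas_symm (chart_mem_atlas ℂ (f z.1)) (e.map_source hsrc))
        mdifferentiableAt_fst
  rw [← modelWithCornersSelf_prod, chartedSpaceSelf_prod,
    mdifferentiableAt_iff_differentiableAt] at h1
  have h2 := h1.star_star
  have h3 : MDifferentiableAt (𝓘(ℂ).prod 𝓘(ℂ, Fin m → ℂ)) 𝓘(ℂ)
      (star ∘ (fun w : ℂ × (Fin m → ℂ) => φ (e.symm w.1, w.2)) ∘ star)
      (conj (e (f z.1)), z.2) := by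
    rw [← modelWithCornersSelf_prod, chartedSpaceSelf_prod,
      mdifferentiableAt_iff_differentiableAt]
    simpa [Prod.star_def] using h2
  have h4 := MDifferentiableAt.comp (I' := 𝓘(ℂ).prod 𝓘(ℂ, Fin m → ℂ))
    (f := fun y : X × (Fin m → ℂ) => (conj (e (f y.1)), y.2)) z h3
    (((hf.2 z.1).comp z mdifferentiableAt_fst).prodMk mdifferentiableAt_snd)
  refine h4.congr_of_eventuallyEq ?_
  have hn : (fun y : X × (Fin m → ℂ) => f y.1) ⁻¹' e.source ∈ 𝓝 z :=
    (hf.1.comp continuous_fst).continuousAt.preimage_mem_nhds (e.open_source.mem_nhds hsrc)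
  filter_upwards [hn] with y hy
  have hy' : e.symm (e (f y.1)) = f y.1 := e.left_inv hy
  simp [Prod.star_def, hy']

theorem mdifferentiableAt_autTwist_prod_star {m : ℕ} {σ : AutPM X}
    (hσ : IsAntiholomorphic (σ.1 : X → X)) {φ : X × (Fin m → ℂ) → ℂ}
    {z : X × (Fin m → ℂ)}
    (hφ : MDifferentiableAt (𝓘(ℂ).prod 𝓘(ℂ, Fin m → ℂ)) 𝓘(ℂ) φ (σ.1.symm z.1, star z.2)) :
    MDifferentiableAt (𝓘(ℂ).prod 𝓘(ℂ, Fin m → ℂ)) 𝓘(ℂ)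
      (fun y : X × (Fin m → ℂ) => autTwist σ (φ (σ.1.symm y.1, star y.2))) z := by
  have : Nonempty X := ⟨z.1⟩
  have h' : IsAntiholomorphic (σ.1.symm : X → X) := by
    rcases σ.2 with ⟨k, _⟩ | ⟨_, k⟩
    · exact absurd k (not_holomorphic_of_isAntiholomorphic hσ)
    · exact k
  rw [autTwist_of_isAntiholomorphic hσ]
  exact h'.conj_comp_prod hφ

/-- The transform of a family of bundles by `σ` on `X` and by `κ` on the parameters, when the
functions on `X × ℂᵐ` are transformed holomorphically. -/
noncomputable def HolFamily.act {r m : ℕ} {T : Set (Fin m → ℂ)} (σ : AutPM X)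
    (κ : (Fin m → ℂ) → Fin m → ℂ) (hκ : Continuous κ)
    (hσκ : ∀ (φ : X × (Fin m → ℂ) → ℂ) (z : X × (Fin m → ℂ)),
      MDifferentiableAt (𝓘(ℂ).prod 𝓘(ℂ, Fin m → ℂ)) 𝓘(ℂ) φ (σ.1.symm z.1, κ z.2) →
      MDifferentiableAt (𝓘(ℂ).prod 𝓘(ℂ, Fin m → ℂ)) 𝓘(ℂ)
        (fun y : X × (Fin m → ℂ) => autTwist σ (φ (σ.1.symm y.1, κ y.2))) z)
    (W : HolFamily X r T) : HolFamily X r (κ ⁻¹' T) where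
  ι := W.ι
  U i := (fun z => (σ.1.symm z.1, κ z.2)) ⁻¹' W.U i
  isOpen_U i := (W.isOpen_U i).preimage
    ((σ.1.symm.continuous.comp continuous_fst).prodMk (hκ.comp continuous_snd))
  cover z hz := W.cover (σ.1.symm z.1, κ z.2) ⟨mem_univ _, hz.2⟩
  g i j z := (W.g i j (σ.1.symm z.1, κ z.2)).map (autTwist σ)
  holomorphic_g i j p q := fun z hz =>
    (hσκ (fun x => W.g i j x p q) z ((W.holomorphic_g i j p q).mdifferentiableAt
      (((W.isOpen_U i).inter (W.isOpen_U j)).mem_nhds hz))).mdifferentiableWithinAt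
  g_self i z hz := by simp [W.g_self i _ hz]
  g_mul i j k z hz := by rw [← Matrix.map_mul, W.g_mul i j k _ hz]

/-- The cocycles agree definitionally; the covers differ only in that one is written as preimages
under `σ⁻¹` and the other as images under `σ`. -/
theorem HolFamily.act_fiber {r m : ℕ} {T : Set (Fin m → ℂ)} (σ : AutPM X)
    {κ : (Fin m → ℂ) → Fin m → ℂ} (hκ : Continuous κ) (hσκ) (W : HolFamily X r T)
    (t : Fin m → ℂ) (ht : κ t ∈ T) :
    (W.act σ κ hκ hσκ).fiber t ht = HolBundle.act σ (W.fiber (κ t) ht) := by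
  refine HolBundle.ext_of_eq ?_ rfl
  funext i
  exact (σ.1.toEquiv.image_eq_preimage_symm {x | (x, κ t) ∈ W.U i}).symm

end Families

/-! ### The action on the moduli space and its holomorphy -/

namespace ModuliSpace

variable {X : Type u} [TopologicalSpace X] [ChartedSpace ℂ X]

theorem mk_congr {r : ℕ} {d : ℤ} {E F : HolBundle X (Fin r)} (h : E = F)
    (hE : HolBundle.IsStable E) (hd : HolBundle.HasDegree E d) :
    mk E hE hd = mk F (h ▸ hE) (h ▸ hd) := by
  subst h
  rfl

variable [IsManifold 𝓘(ℂ) ω X] [Nonempty X]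

/-- The map `[E] ↦ [σ(E)]` on the moduli space. -/
noncomputable def act {r : ℕ} {d : ℤ} (σ : AutPM X) : ModuliSpace X r d → ModuliSpace X r d :=
  Quotient.map (fun E => ⟨HolBundle.act σ E.1, E.2.1.act σ, E.2.2.act σ⟩) fun _ _ h => h.act σ

/-- The action of a group of automorphisms of `X` on the moduli space. -/
@[reducible]
noncomputable def mulAction (S : Subgroup (AutPM X)) (r : ℕ) (d : ℤ) :
    MulAction S (ModuliSpace X r d) where
  smul σ P := act σ.1 P
  one_smul P := by
    induction P using Quotient.inductionOn with
    | h E => exact mk_congr (HolBundle.act_one E.1) (E.2.1.act 1) (E.2.2.act 1)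
  mul_smul σ τ P := by
    induction P using Quotient.inductionOn with
    | h E =>
      exact mk_congr (HolBundle.act_mul σ.1 τ.1 E.1) (E.2.1.act (σ.1 * τ.1))
        (E.2.2.act (σ.1 * τ.1))

/-- A local family inducing `p` near `κ t₀` is transformed into one inducing `t ↦ σ · p (κ t)` near
`t₀`. The parameter map `κ` is kept general so that the identity and `star` give the holomorphic and
the anti-holomorphic statement respectively. -/
theorem IsHolomorphicOn.act {r m : ℕ} {d : ℤ} {p : (Fin m → ℂ) → ModuliSpace X r d}
    {T : Set (Fin m → ℂ)} (hp : IsHolomorphicOn p T) (σ : AutPM X)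
    {κ : (Fin m → ℂ) → Fin m → ℂ} (hκ : Continuous κ)
    (hσκ : ∀ (φ : X × (Fin m → ℂ) → ℂ) (z : X × (Fin m → ℂ)),
      MDifferentiableAt (𝓘(ℂ).prod 𝓘(ℂ, Fin m → ℂ)) 𝓘(ℂ) φ (σ.1.symm z.1, κ z.2) →
      MDifferentiableAt (𝓘(ℂ).prod 𝓘(ℂ, Fin m → ℂ)) 𝓘(ℂ)
        (fun y : X × (Fin m → ℂ) => autTwist σ (φ (σ.1.symm y.1, κ y.2))) z) :
    IsHolomorphicOn (fun t => ModuliSpace.act σ (p (κ t))) (κ ⁻¹' T) := by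
  intro t₀ ht₀
  obtain ⟨T', hT', ht₀', hsub, W, hW⟩ := hp (κ t₀) ht₀
  refine ⟨κ ⁻¹' T', hT'.preimage hκ, ht₀', preimage_mono hsub, W.act σ κ hκ hσκ, ?_⟩
  intro t ht
  obtain ⟨hs, hd, hpt⟩ := hW (κ t) ht
  have hfib := W.act_fiber σ hκ hσκ t ht
  refine ⟨hfib ▸ hs.act σ, hfib ▸ hd.act σ, ?_⟩
  exact (congrArg (ModuliSpace.act σ) hpt).trans (mk_congr hfib.symm (hs.act σ) (hd.act σ))

end ModuliSpace

theorem proposition1p1 (X : Type u) [TopologicalSpace X] [T2Space X] [CompactSpace X]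
    [ConnectedSpace X] [ChartedSpace ℂ X] [IsManifold 𝓘(ℂ) ω X] (S : Subgroup (AutPM X)) :
    (∀ (σ : S) (r : ℕ) (E : HolBundle X (Fin r)),
      HolBundle.IsStable (HolBundle.act σ.1 E) ↔ HolBundle.IsStable E) ∧
    ∀ (r : ℕ) (d : ℤ), ∃ a : MulAction S (ModuliSpace X r d),
      (∀ (σ : S) (E : HolBundle X (Fin r)) (hs : HolBundle.IsStable E)
        (hd : HolBundle.HasDegree E d),
        ∃ (hs' : HolBundle.IsStable (HolBundle.act σ.1 E))
          (hd' : HolBundle.HasDegree (HolBundle.act σ.1 E) d),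
          a.smul σ (ModuliSpace.mk E hs hd) = ModuliSpace.mk (HolBundle.act σ.1 E) hs' hd') ∧
      ∀ σ : S,
        (MDifferentiable 𝓘(ℂ) 𝓘(ℂ) (σ.1.1 : X → X) →
          ModuliSpace.IsHolomorphicSelfMap (fun P : ModuliSpace X r d => a.smul σ P)) ∧
        (IsAntiholomorphic (σ.1.1 : X → X) →
          ModuliSpace.IsAntiholomorphicSelfMap (fun P : ModuliSpace X r d => a.smul σ P)) := by
  refine ⟨fun σ r E => HolBundle.isStable_act_iff σ.1, fun r d =>
    ⟨ModuliSpace.mulAction S r d, fun σ E hs hd => ⟨hs.act σ.1, hd.act σ.1, rfl⟩, fun σ =>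
      ⟨fun hσ m T p _ hp => ?_, fun hσ m T p _ hp => ?_⟩⟩⟩
  -- The preimages of `T` under the identity and under `star` are definitionally the parameter sets
  -- required in the two cases.
  · exact hp.act σ.1 continuous_id fun φ z hφ => mdifferentiableAt_autTwist_prod hσ hφ
  · exact hp.act σ.1 continuous_star fun φ z hφ => mdifferentiableAt_autTwist_prod_star hσ hφ
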